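/- Let $\mathcal L$ be a countable language with a fixed computable representation (its relation and function symbols are indexed by disjoint computable subsets of $\omega$, with computable arities). All structures are $\mathcal L$-structures. A structure $M$ is \emph{computable} if its underlying set is a computable subset of $\omega$ and, uniformly in the symbols, its relations, the complements of its relations, and the graphs of its functions are c.e. \emph{Notation.} For a finite tuple $\mathbf a$ in $M$ let $\mathrm{cl}_M(\mathbf a)$ be the substructure of $M$ generated by $\mathbf a$. For tuples $\mathbf a,\mathbf b$ of the same length (possibly in different structures) write $\mathbf a\sim\mathbf b$ if $a_i=a_j\Leftrightarrow b_i=b_j$ for all $i,j$, and $\mathbf a\approx\mathbf b$ if $\mathbf a$ and $\mathbf b$ satisfy the same atomic $\mathcal L$-formulas. The \emph{age} of $M$ is the class of finitely generated structures that embed in $M$. A member $A$ of the age is an \emph{amalgamation base} if for all members $B,C$ of the age and all embeddings $f:A\to B$, $g:A\to C$ there are a member $D$ of the age and embeddings $\alpha:B\to D$, $\beta:C\to D$ with $\alpha f=\beta g$. $M$ is \emph{cofinally ultrahomogeneous} if for every finite $A\subseteq M$ there is a finitely generated substructure $B\supseteq A$ of $M$ such that every isomorphism from $B$ onto a substructure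 of $M$ extends to an automorphism of $M$. A \emph{cofinal collection} in $M$ is a set $E$ of finite tuples of $M$ such that (1) for every finite tuple $\mathbf a$ in $M$ there is $\mathbf b\in E$ with $\mathbf a\subseteq\mathrm{cl}_M(\mathbf b)$; (2) if $\mathbf b\in E$ and $\mathbf a\subseteq\mathrm{cl}_M(\mathbf b)$ is a finite tuple then the concatenation $\mathbf a\mathbf b$ is in $E$; (3) if $\mathbf a\in E$ and $\mathbf a\approx\mathbf b$ with $\mathbf b$ in $M$ then $\mathbf b\in E$. For $S\subseteq\omega$, a computable structure $M$ is \emph{$S$-computably cofinally ultrahomogeneous with respect to} a cofinal collection $E$ if $E$ is $S$-computable and there is an $S$-computable partial function $g$ whose domain is the set of pairs $(\mathbf a,\mathbf b)$ of tuples of $M$ with $\mathbf a\in E$ and $\mathbf a\sim\mathbf b$, such that for every such pair $g(\mathbf a,\mathbf b)$ is an index of an $S$-computable bijection $g_{\mathbf a,\mathbf b}:M\to M$ with $g_{\mathbf a,\mathbf b}(\mathbf a)=\mathbf b$, which is an automorphism of $M$ whenever $\mathbf a\approx\mathbf b$. $M$ is \emph{$S$-computably cofinally ultrahomogeneous} if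 this holds with respect to some cofinal collection $E$. Let $M$ be a computable structure and let $(\mathbf a_i)_{i\in\omega}$ be a computable enumeration of all finite tuples of $M$ in which every tuple occurs infinitely often. Let $\mathrm{EmbedInfo}(M)\subseteq\omega$ be the set of (codes of) quadruples $(k_0,\mathbf b_0,k_1,\mathbf b_1)$ such that $\mathbf b_0$ is a finite tuple in $\mathrm{cl}_M(\mathbf a_{k_0})$, $\mathbf b_1$ is a finite tuple in $\mathrm{cl}_M(\mathbf a_{k_1})$, and $\mathbf b_0\approx\mathbf b_1$. \textbf{Theorem.} Let $M$ be a computable structure that is cofinally ultrahomogeneous. Then, for any such enumeration $(\mathbf a_i)_{i\in\omega}$, $M$ is $\mathrm{EmbedInfo}(M)''$-computably cofinally ultrahomogeneous, where $''$ denotes the double Turing jump. Moreover, it is so with respect to the collection $E$ of all finite tuples $\mathbf a$ of $M$ for which $\mathrm{cl}_M(\mathbf a)$ is an amalgamation base in the age of $M$. -/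

import Mathlib

/-! ## Oracle computability: codes, indices, and the Turing jump -/

universe u v w

namespace CofUH

open Classical in
/-- The characteristic function of a set of natural numbers, as an oracle. -/
noncomputable def oracleOf (S : Set ℕ) : ℕ →. ℕ :=
  fun n => Part.some (if n ∈ S then 1 else 0)

/-- Codes for partial functions that are recursive in an oracle. -/
inductive OracleCode : Type
  | zero : OracleCode
  | succ : OracleCode
  | left : OracleCode
  | right : OracleCode
  | oracle : OracleCode
  | pair : OracleCode → OracleCode → OracleCode
  | comp : OracleCode → OracleCode → OracleCode
  | prec : OracleCode → OracleCode → OracleCode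
  | rfind : OracleCode → OracleCode

namespace OracleCode

/-- The partial function computed by a code from the oracle `g`. -/
def eval (g : ℕ →. ℕ) : OracleCode → ℕ →. ℕ
  | zero => fun _ => Part.some 0
  | succ => fun n => Part.some (n + 1)
  | left => fun n => Part.some n.unpair.1
  | right => fun n => Part.some n.unpair.2
  | oracle => g
  | pair c d => fun n => Nat.pair <$> eval g c n <*> eval g d n
  | comp c d => fun n => eval g d n >>= eval g c
  | prec c d => fun p =>
      p.unpair.2.rec (eval g c p.unpair.1) fun y IH => do
        let i ← IH
        eval g d (Nat.pair p.unpair.1 (Nat.pair y i))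
  | rfind c => fun a =>
      Nat.rfind fun n => (fun m => decide (m = 0)) <$> eval g c (Nat.pair a n)

/-- The index of a code, in an effective numbering of all codes. -/
def index : OracleCode → ℕ
  | zero => 0
  | succ => 1
  | left => 2
  | right => 3
  | oracle => 4
  | pair c d => 4 * Nat.pair (index c) (index d) + 5
  | comp c d => 4 * Nat.pair (index c) (index d) + 6
  | prec c d => 4 * Nat.pair (index c) (index d) + 7
  | rfind c => 4 * index c + 8

theorem index_injective : Function.Injective index := by
  intro c
  induction c with
  | zero | succ | left | right | oracle =>
    intro d h
    cases d <;> simp only [index] at h <;> first | rfl | omega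
  | pair c₁ c₂ ih₁ ih₂ | comp c₁ c₂ ih₁ ih₂ | prec c₁ c₂ ih₁ ih₂ =>
    intro d h
    cases d with
    | pair d₁ d₂ | comp d₁ d₂ | prec d₁ d₂ =>
      simp only [index] at h
      first
        | omega
        | (have h' : Nat.pair (index c₁) (index c₂) = Nat.pair (index d₁) (index d₂) := by omega
           rw [Nat.pair_eq_pair] at h'
           rw [ih₁ h'.1, ih₂ h'.2])
    | _ => simp only [index] at h; omega
  | rfind c ih =>
    intro d h
    cases d with
    | rfind d =>
      simp only [index] at h
      rw [ih (show index c = index d by omega)]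
    | _ => simp only [index] at h; omega

/-- The functions with a code are exactly those recursive in the oracle. -/
theorem exists_code_iff {g f : ℕ →. ℕ} :
    (∃ c : OracleCode, eval g c = f) ↔ RecursiveIn {g} f := by
  rw [RecursiveIn.iff_nat]
  constructor
  · rintro ⟨c, rfl⟩
    induction c with
    | zero => exact .zero
    | succ => exact .succ
    | left => exact .left
    | right => exact .right
    | oracle => exact .oracle g rfl
    | pair c d hc hd => exact .pair hc hd
    | comp c d hc hd => exact .comp hc hd
    | prec c d hc hd => exact .prec hc hd
    | rfind c hc => exact .rfind hc
  · intro h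
    induction h with
    | zero => exact ⟨zero, rfl⟩
    | succ => exact ⟨succ, rfl⟩
    | left => exact ⟨left, rfl⟩
    | right => exact ⟨right, rfl⟩
    | oracle k hk => exact ⟨oracle, (Set.mem_singleton_iff.1 hk).symm⟩
    | pair _ _ h₁ h₂ =>
      obtain ⟨c, rfl⟩ := h₁; obtain ⟨d, rfl⟩ := h₂; exact ⟨pair c d, rfl⟩
    | comp _ _ h₁ h₂ =>
      obtain ⟨c, rfl⟩ := h₁; obtain ⟨d, rfl⟩ := h₂; exact ⟨comp c d, rfl⟩
    | prec _ _ h₁ h₂ =>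
      obtain ⟨c, rfl⟩ := h₁; obtain ⟨d, rfl⟩ := h₂; exact ⟨prec c d, rfl⟩
    | rfind _ h₁ => obtain ⟨c, rfl⟩ := h₁; exact ⟨rfind c, rfl⟩

end OracleCode

/-- `e` is an index of the partial function `f` relative to the set `S`. -/
def IsIndexIn (S : Set ℕ) (e : ℕ) (f : ℕ →. ℕ) : Prop :=
  ∃ c : OracleCode, c.index = e ∧ c.eval (oracleOf S) = f

/-- The Turing jump of `S`: the indices `e` whose computation from `S` halts on input `e`. -/
def turingJump (S : Set ℕ) : Set ℕ :=
  {e | ∃ c : OracleCode, c.index = e ∧ (c.eval (oracleOf S) e).Dom}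

/-- The predicate `p` is decidable by an algorithm with oracle `S`. -/
def ComputablePredIn {α : Type*} [Primcodable α] (S : Set ℕ) (p : α → Prop) : Prop :=
  ∃ _ : DecidablePred p, ComputableIn {oracleOf S} fun x => decide (p x)

/-! ## Computable languages and structures -/

open FirstOrder FirstOrder.Language

/-- A computable representation of a language. -/
structure ComputableRepresentation (L : FirstOrder.Language.{u, v}) where
  /-- the codes of relation symbols -/
  relDom : Set ℕ
  /-- the codes of function symbols -/
  funDom : Set ℕ
  relDom_computable : ComputablePred fun n => n ∈ relDom
  funDom_computable : ComputablePred fun n => n ∈ funDom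
  disjoint : Disjoint relDom funDom
  rel : relDom ≃ Σ n, L.Relations n
  func : funDom ≃ Σ n, L.Functions n
  /-- the arity of the symbol with a given code (arbitrary on numbers that are not codes) -/
  arity : ℕ → ℕ
  arity_computable : Computable arity
  arity_rel : ∀ r : relDom, arity r = (rel r).1
  arity_func : ∀ f : funDom, arity f = (func f).1

/-- The tuple of natural numbers underlying a tuple from a subset of `ℕ`. -/
def rawTuple {M : Set ℕ} (a : List M) : List ℕ := a.map Subtype.val

/-- `M` is a computable structure: its underlying set is a computable subset of `ℕ`, and its
relations, their complements, and the graphs of its functions are (uniformly) c.e. -/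
structure IsComputableStructure {L : FirstOrder.Language.{u, v}} (ρ : ComputableRepresentation L)
    (M : Set ℕ) [L.Structure M] : Prop where
  carrier : ComputablePred fun n => n ∈ M
  rel_re : REPred fun p : ℕ × List ℕ =>
    ∃ (r : ρ.relDom) (x : Fin (ρ.rel r).1 → M),
      p = (↑r, rawTuple (List.ofFn x)) ∧ Structure.RelMap (ρ.rel r).2 x
  not_rel_re : REPred fun p : ℕ × List ℕ =>
    ∃ (r : ρ.relDom) (x : Fin (ρ.rel r).1 → M),
      p = (↑r, rawTuple (List.ofFn x)) ∧ ¬ Structure.RelMap (ρ.rel r).2 x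
  fun_re : REPred fun p : ℕ × List ℕ × ℕ =>
    ∃ (f : ρ.funDom) (x : Fin (ρ.func f).1 → M),
      p = (↑f, rawTuple (List.ofFn x), ↑(Structure.funMap (ρ.func f).2 x))

/-! ## Tuples -/

/-- The substructure generated by a finite tuple. -/
abbrev tupleClosure (L : FirstOrder.Language.{u, v}) {M : Type w} [L.Structure M] (a : List M) :
    L.Substructure M :=
  Substructure.closure L {x | x ∈ a}

/-- Two tuples of the same length have the same pattern of equalities between coordinates. -/
def TupleSim {M N : Type*} (a : List M) (b : List N) : Prop :=
  ∃ h : a.length = b.length, ∀ i j : Fin a.length,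
    a.get i = a.get j ↔ b.get (i.cast h) = b.get (j.cast h)

/-- Two tuples of the same length satisfy the same atomic formulas, each in its structure. -/
def ClSim (L : FirstOrder.Language.{u, v}) {M N : Type*} [L.Structure M] [L.Structure N]
    (a : List M) (b : List N) : Prop :=
  ∃ h : a.length = b.length, ∀ φ : L.Formula (Fin a.length), φ.IsAtomic →
    (φ.Realize a.get ↔ φ.Realize fun i => b.get (i.cast h))

/-! ## Embedding information -/

/-- `a` is a computable enumeration of all finite tuples in `M` in which every tuple appears
infinitely often. The canonical computable age of `M` given by `a` is the sequence
`(a i, tupleClosure L (a i), i)`. -/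
structure IsCanonicalEnumeration {M : Set ℕ} (a : ℕ → List M) : Prop where
  computable : Computable fun i => rawTuple (a i)
  infinitely_often : ∀ t : List M, {i | a i = t}.Infinite

/-- The embedding information of the canonical age of `M` given by `a`: the (coded) tuples
`(k₀, b₀, k₁, b₁)` where `bᵢ` is a tuple in the `kᵢ`-th structure of the age and `b₀`, `b₁`
satisfy the same atomic formulas, each in its structure. -/
def embedInfo (L : FirstOrder.Language.{u, v}) {M : Set ℕ} [L.Structure M] (a : ℕ → List M) : Set ℕ :=
  {e | ∃ (k₀ k₁ : ℕ) (b₀ : List (tupleClosure L (a k₀))) (b₁ : List (tupleClosure L (a k₁))),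
    ClSim L b₀ b₁ ∧
    e = Encodable.encode
      (k₀, rawTuple (b₀.map Subtype.val), k₁, rawTuple (b₁.map Subtype.val))}

/-! ## Cofinal ultrahomogeneity -/

/-- Cofinal ultrahomogeneity of a structure. -/
def CofinallyUltrahomogeneous (L : FirstOrder.Language.{u, v}) (M : Type w) [L.Structure M] : Prop :=
  ∀ A : Set M, A.Finite → ∃ B : L.Substructure M, B.FG ∧ A ⊆ B ∧
    ∀ (B' : L.Substructure M) (f : B ≃[L] B'), ∃ g : M ≃[L] M, ∀ x : B, g x = f x

/-- Cofinal collections of finite tuples. -/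
structure IsCofinalCollection (L : FirstOrder.Language.{u, v}) {M : Type w} [L.Structure M]
    (E : Set (List M)) : Prop where
  cofinal : ∀ a : List M, ∃ b ∈ E, ∀ x ∈ a, x ∈ tupleClosure L b
  append : ∀ b ∈ E, ∀ a : List M, (∀ x ∈ a, x ∈ tupleClosure L b) → a ++ b ∈ E
  clSim : ∀ a ∈ E, ∀ b : List M, ClSim L a b → b ∈ E

/-- `A` is an amalgamation base in the class `K`. -/
def IsAmalgamationBase {L : FirstOrder.Language.{u, v}} (K : Set (CategoryTheory.Bundled.{w} L.Structure))
    (A : CategoryTheory.Bundled.{w} L.Structure) : Prop :=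
  A ∈ K ∧ ∀ B ∈ K, ∀ C ∈ K, ∀ (f : A ↪[L] B) (g : A ↪[L] C),
    ∃ D ∈ K, ∃ (α : B ↪[L] D) (β : C ↪[L] D), α.comp f = β.comp g

/-- The tuples of `M` that generate an amalgamation base in the age of `M`. -/
def amalgamationBaseTuples (L : FirstOrder.Language.{u, v}) (M : Type w) [L.Structure M] : Set (List M) :=
  {a | IsAmalgamationBase (L.age M) (CategoryTheory.Bundled.of (tupleClosure L a))}

/-- The structure `M ⊆ ℕ` is `S`-computably cofinally ultrahomogeneous with respect to `E`. -/
def ComputablyCofinallyUltrahomogeneousFor (L : FirstOrder.Language.{u, v}) (M : Set ℕ) [L.Structure M]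
    (S : Set ℕ) (E : Set (List M)) : Prop :=
  IsCofinalCollection L E ∧
  ComputablePredIn S (fun l : List ℕ => ∃ a ∈ E, rawTuple a = l) ∧
  ∃ g : List ℕ × List ℕ →. ℕ,
    RecursiveIn {oracleOf S} g ∧
    (∀ p, (g p).Dom ↔ ∃ a b : List M, a ∈ E ∧ TupleSim a b ∧ p = (rawTuple a, rawTuple b)) ∧
    ∀ a b : List M, a ∈ E → TupleSim a b → ∀ e ∈ g (rawTuple a, rawTuple b),
      ∃ (σ : M ≃ M) (f : ℕ →. ℕ),
        IsIndexIn S e f ∧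
        (∀ n m : ℕ, m ∈ f n ↔ ∃ x : M, (x : ℕ) = n ∧ (σ x : ℕ) = m) ∧
        a.map σ = b ∧
        (ClSim L a b → ∃ τ : M ≃[L] M, ∀ x, τ x = σ x)

/-- The structure `M ⊆ ℕ` is `S`-computably cofinally ultrahomogeneous: it is so with respect to
some (`S`-computable) cofinal collection. -/
def ComputablyCofinallyUltrahomogeneous (L : FirstOrder.Language.{u, v}) (M : Set ℕ) [L.Structure M]
    (S : Set ℕ) : Prop :=
  ∃ E : Set (List M), ComputablyCofinallyUltrahomogeneousFor L M S E

end CofUH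

/-! Call a tuple homogeneous (`IsHomogeneousTuple`) if every tuple `≈`-equivalent to it is its image
under an automorphism. In a cofinally ultrahomogeneous structure these are exactly the tuples
generating an amalgamation base (`CofinallyUltrahomogeneous.amalgamationBaseTuples_eq`), and for
homogeneous tuples the axioms of a cofinal collection are immediate.

Homogeneity is arithmetical: `a` is homogeneous iff for all `b`, `e` with `a ≈ b` some `f` satisfies
`ae ≈ bf` (`CofinallyUltrahomogeneous.isHomogeneousTuple_iff`). On enumerated tuples `≈` is decided
by EmbedInfo, so this condition is Π₂ in EmbedInfo and the double jump decides it.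

The bijections come from one back-and-forth search, `backForth`, driven by a relation `T` with an
extension property. For pairs with `a ≈ b`, `T` is `≈` with a homogeneous left side; for other pairs
it is `∼`. In the first case every finite part of the limit agrees with an automorphism, so the
limit is one (`exists_equiv_of_locally_automorphism`). Indices are obtained by an s-m-n argument
(`exists_computable_index`), and the oracle decides which of the two constructions to use. -/

namespace CofUH

open FirstOrder FirstOrder.Language

/-! ### Atomic types, homogeneous tuples and amalgamation bases. -/

section ModelTheory

variable {L : FirstOrder.Language.{u, v}}

theorem clSim_of_embedding {M N : Type*} [L.Structure M] [L.Structure N] (a : List M)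
    (φ : M ↪[L] N) : ClSim L a (a.map φ) := by
  refine ⟨by simp, fun ψ hψ => ?_⟩
  have h := hψ.isQF.realize_embedding φ (v := a.get) (xs := default)
  rw [Formula.Realize, ← h, Formula.Realize]
  have h1 : (fun i : Fin a.length => (a.map φ).get (i.cast (by simp))) = φ ∘ a.get := by
    funext i
    simp
  rw [h1]
  exact iff_of_eq (congrArg _ (Subsingleton.elim _ _))

/-- Indexing both tuples by the same `Fin n` removes the length cast. -/
theorem clSim_ofFn {M N : Type*} [L.Structure M] [L.Structure N] {n : ℕ} {a : Fin n → M}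
    {b : Fin n → N} : ClSim L (List.ofFn a) (List.ofFn b) ↔
      ∀ φ : L.Formula (Fin n), φ.IsAtomic → (φ.Realize a ↔ φ.Realize b) := by
  have key : ∀ {m : ℕ} (a' : List M) (b' : List N) (hm : a'.length = m) (hb : b'.length = m),
      ClSim L a' b' ↔ ∀ φ : L.Formula (Fin m), φ.IsAtomic →
        (φ.Realize (fun i => a'.get (i.cast hm.symm)) ↔
          φ.Realize fun i => b'.get (i.cast hb.symm)) := by
    rintro m a' b' rfl hb
    exact ⟨fun h => h.2, fun h => ⟨hb.symm, h⟩⟩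
  rw [key (m := n) _ _ (by simp) (by simp)]
  simp

theorem exists_ofFn_pair {M N : Type*} {a : List M} {b : List N} (h : a.length = b.length) :
    ∃ (n : ℕ) (x : Fin n → M) (y : Fin n → N), a = List.ofFn x ∧ b = List.ofFn y :=
  ⟨a.length, a.get, fun i => b.get (i.cast h), (List.ofFn_get a).symm, by
    apply List.ext_get <;> simp [h]⟩

theorem ClSim.symm {M N : Type*} [L.Structure M] [L.Structure N] {a : List M} {b : List N}
    (h : ClSim L a b) : ClSim L b a := by
  obtain ⟨n, x, y, rfl, rfl⟩ := exists_ofFn_pair h.1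
  rw [clSim_ofFn] at h ⊢
  exact fun φ hφ => (h φ hφ).symm

theorem ClSim.trans {M N P : Type*} [L.Structure M] [L.Structure N] [L.Structure P] {a : List M}
    {b : List N} {c : List P} (h : ClSim L a b) (h' : ClSim L b c) : ClSim L a c := by
  refine ⟨h.1.trans h'.1, fun φ hφ => ?_⟩
  obtain ⟨n, x, y, rfl, rfl⟩ := exists_ofFn_pair h.1
  have hl : c.length = n := by simpa using h'.1.symm
  obtain ⟨z, rfl⟩ : ∃ z : Fin n → P, c = List.ofFn z := by
    subst hl
    exact ⟨c.get, (List.ofFn_get c).symm⟩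
  rw [clSim_ofFn] at h h'
  exact (clSim_ofFn.2 fun φ hφ => (h φ hφ).trans (h' φ hφ)).2 φ hφ

theorem ClSim.tupleSim {M N : Type*} [L.Structure M] [L.Structure N] {a : List M} {b : List N}
    (h : ClSim L a b) : TupleSim a b := by
  refine ⟨h.1, fun i j => ?_⟩
  have := h.2 (Term.equal (Term.var i) (Term.var j)) (BoundedFormula.IsAtomic.equal _ _)
  simpa [Formula.realize_equal] using this

/-- A tuple, as a tuple of the substructure that it generates. -/
def tupleInClosure (L : FirstOrder.Language.{u, v}) {M : Type*} [L.Structure M] (a : List M) :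
    List (tupleClosure L a) :=
  a.attach.map fun x => ⟨x.1, Substructure.subset_closure x.2⟩

theorem map_val_tupleInClosure {M : Type*} [L.Structure M] (a : List M) :
    (tupleInClosure L a).map Subtype.val = a := by
  simp [tupleInClosure, Function.comp_def]

theorem closure_tupleInClosure {M : Type*} [L.Structure M] (a : List M) :
    Substructure.closure L {x | x ∈ tupleInClosure L a} = ⊤ := by
  rw [eq_top_iff]
  rintro ⟨x, hx⟩ -
  have h : (tupleClosure L a).subtype.toHom '' {x | x ∈ tupleInClosure L a} = {x | x ∈ a} := by
    ext y
    conv_rhs => rw [← map_val_tupleInClosure (L := L) a]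
    simp
  have h' : x ∈ (Substructure.closure L {x | x ∈ tupleInClosure L a}).map
      (tupleClosure L a).subtype.toHom := by
    rwa [Substructure.map_closure, h]
  obtain ⟨y, hy, rfl⟩ := h'
  exact hy

theorem embedding_ext_of_map_eq {M N : Type*} [L.Structure M] [L.Structure N] {a : List M}
    {φ ψ : tupleClosure L a ↪[L] N}
    (h : (tupleInClosure L a).map φ = (tupleInClosure L a).map ψ) : φ = ψ := by
  have : φ.toHom = ψ.toHom :=
    Hom.eq_of_eqOn_dense (closure_tupleInClosure a) (List.map_inj_left.1 h)
  ext x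
  exact congrArg (fun f : tupleClosure L a →[L] N => f x) this

/-- Each element of the closure is the value of a term at `a`; it is sent to the value of the same
term at `b`. Atomic equalities make this independent of the term, injective and compatible with
functions; the other atomic formulas give the relations. -/
theorem ClSim.exists_embedding {M N : Type*} [L.Structure M] [L.Structure N] {a : List M}
    {b : List N} (h : ClSim L a b) :
    ∃ φ : tupleClosure L a ↪[L] N, (tupleInClosure L a).map φ = b := by
  obtain ⟨n, x, y, rfl, rfl⟩ := exists_ofFn_pair h.1
  rw [clSim_ofFn] at h
  have hterm : ∀ z : tupleClosure L (List.ofFn x), ∃ t : L.Term (Fin n), t.realize x = z := by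
    rintro ⟨z, hz⟩
    obtain ⟨t, rfl⟩ := Substructure.mem_closure_iff_exists_term.1 hz
    have : ∀ w : {w | w ∈ List.ofFn x}, ∃ i, x i = w := fun w => by
      simpa [List.mem_ofFn] using w.2
    choose i hi using this
    exact ⟨t.relabel i, by simp [Function.comp_def, hi]⟩
  choose T hT using hterm
  have heq : ∀ s t : L.Term (Fin n), s.realize x = t.realize x ↔ s.realize y = t.realize y :=
    fun s t => by
      simpa [Formula.realize_equal] using h (Term.equal s t) (BoundedFormula.IsAtomic.equal _ _)
  have hrel : ∀ {k : ℕ} (R : L.Relations k) (ts : Fin k → L.Term (Fin n)),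
      Structure.RelMap R (fun i => (ts i).realize x) ↔
        Structure.RelMap R (fun i => (ts i).realize y) := fun R ts => by
    simpa [Formula.realize_rel] using h (R.formula ts) (BoundedFormula.IsAtomic.rel _ _)
  refine ⟨⟨⟨fun z => (T z).realize y, fun z w hzw => ?_⟩, fun {k} f z => ?_, fun {k} R z => ?_⟩,
    ?_⟩
  · exact Subtype.ext (by rw [← hT, ← hT, heq]; exact hzw)
  · have : (T (Structure.funMap f z)).realize x = (Term.func f fun i => T (z i)).realize x := by
      rw [hT]
      simp only [Term.realize, hT]
      rfl
    exact (heq _ _).1 this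
  · have := hrel R fun i => T (z i)
    simp only [hT] at this
    exact this.symm
  · apply List.ext_getElem (by simp [tupleInClosure])
    intro i h1 h2
    have hi : i < n := by simpa using h2
    simp only [List.getElem_map, List.getElem_ofFn]
    refine (heq (T _) (Term.var ⟨i, hi⟩)).1 ?_
    rw [hT]
    simp [tupleInClosure]

theorem clSim_map_embedding_tupleInClosure {M N : Type*} [L.Structure M] [L.Structure N]
    (a : List M) (φ : tupleClosure L a ↪[L] N) : ClSim L a ((tupleInClosure L a).map φ) := by
  have h := clSim_of_embedding (L := L) (tupleInClosure L a) (tupleClosure L a).subtype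
  have h' : (tupleInClosure L a).map (tupleClosure L a).subtype = a := map_val_tupleInClosure a
  rw [h'] at h
  exact h.symm.trans (clSim_of_embedding _ φ)

/-- A substructure every embedding of which extends to an automorphism. -/
def IsHomogeneousSubstructure {M : Type*} [L.Structure M] (A : L.Substructure M) : Prop :=
  ∀ φ : A ↪[L] M, ∃ τ : M ≃[L] M, ∀ x : A, τ x = φ x

/-- A tuple whose type is an orbit of the automorphism group. -/
def IsHomogeneousTuple (L : FirstOrder.Language.{u, v}) {M : Type*} [L.Structure M]
    (a : List M) : Prop :=
  ∀ b : List M, ClSim L a b → ∃ τ : M ≃[L] M, a.map τ = b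

theorem isHomogeneousTuple_iff {M : Type*} [L.Structure M] {a : List M} :
    IsHomogeneousTuple L a ↔ IsHomogeneousSubstructure (tupleClosure L a) := by
  constructor
  · intro h φ
    obtain ⟨τ, hτ⟩ := h _ (clSim_map_embedding_tupleInClosure a φ)
    refine ⟨τ, fun x => ?_⟩
    have : τ.toEmbedding.comp (tupleClosure L a).subtype = φ := by
      apply embedding_ext_of_map_eq
      rw [← hτ]
      conv_rhs => rw [← map_val_tupleInClosure (L := L) a]
      rw [List.map_map]
      rfl
    exact congrArg (fun f : tupleClosure L a ↪[L] M => f x) this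
  · intro h b hb
    obtain ⟨φ, rfl⟩ := hb.exists_embedding
    obtain ⟨τ, hτ⟩ := h φ
    refine ⟨τ, ?_⟩
    conv_lhs => rw [← map_val_tupleInClosure (L := L) a]
    rw [List.map_map]
    exact List.map_congr_left fun x _ => hτ x

theorem IsHomogeneousTuple.map {M : Type*} [L.Structure M] {a b : List M}
    (h : IsHomogeneousTuple L a) (hab : ClSim L a b) : IsHomogeneousTuple L b := by
  intro c hc
  obtain ⟨τ, rfl⟩ := h b hab
  obtain ⟨τ', rfl⟩ := h c (hab.trans hc)
  exact ⟨τ'.comp τ.symm, by simp [Function.comp_def]⟩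

theorem tupleClosure_append {M : Type*} [L.Structure M] {a b : List M}
    (h : ∀ x ∈ a, x ∈ tupleClosure L b) : tupleClosure L (a ++ b) = tupleClosure L b := by
  apply le_antisymm
  · rw [tupleClosure, Substructure.closure_le]
    intro x hx
    rcases List.mem_append.1 hx with hx | hx
    · exact h x hx
    · exact Substructure.subset_closure hx
  · exact Substructure.closure_mono fun x hx => List.mem_append_right a hx

theorem IsHomogeneousTuple.append {M : Type*} [L.Structure M] {a b : List M}
    (hb : IsHomogeneousTuple L b) (h : ∀ x ∈ a, x ∈ tupleClosure L b) :
    IsHomogeneousTuple L (a ++ b) := by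
  rw [isHomogeneousTuple_iff] at hb ⊢
  rwa [tupleClosure_append h]

theorem exists_tupleClosure_eq {M : Type*} [L.Structure M] {B : L.Substructure M} (hB : B.FG) :
    ∃ b : List M, tupleClosure L b = B := by
  obtain ⟨S, rfl⟩ := hB
  exact ⟨S.toList, by simp [tupleClosure]⟩

theorem fg_tupleClosure {M : Type*} [L.Structure M] (a : List M) : (tupleClosure L a).FG :=
  Substructure.fg_closure (List.finite_toSet a)

theorem CofinallyUltrahomogeneous.exists_isHomogeneousTuple {M : Type*} [L.Structure M]
    (hU : CofinallyUltrahomogeneous L M) (a : List M) :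
    ∃ b : List M, IsHomogeneousTuple L b ∧ ∀ x ∈ a, x ∈ tupleClosure L b := by
  obtain ⟨B, hB, haB, h⟩ := hU {x | x ∈ a} (List.finite_toSet a)
  obtain ⟨b, rfl⟩ := exists_tupleClosure_eq hB
  refine ⟨b, isHomogeneousTuple_iff.2 fun φ => ?_, haB⟩
  obtain ⟨g, hg⟩ := h φ.toHom.range φ.equivRange
  exact ⟨g, fun x => by rw [hg, Embedding.equivRange_apply]⟩

theorem mem_age_substructure {M : Type w} [L.Structure M] {B : L.Substructure M} (hB : B.FG) :
    (CategoryTheory.Bundled.of B : CategoryTheory.Bundled.{w} L.Structure) ∈ L.age M :=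
  ⟨(Substructure.fg_iff_structure_fg B).1 hB, ⟨B.subtype⟩⟩

/-- Copies of `B` and `C` inside `M` are moved by automorphisms until both contain `A` as it lies in
`M`; the substructure they generate together is the amalgam. -/
theorem IsHomogeneousSubstructure.isAmalgamationBase {M : Type w} [L.Structure M]
    {A : L.Substructure M} (hA : A.FG) (h : IsHomogeneousSubstructure A) :
    IsAmalgamationBase (L.age M) (CategoryTheory.Bundled.of A) := by
  refine ⟨mem_age_substructure hA, ?_⟩
  rintro B ⟨hB, ⟨u⟩⟩ C ⟨hC, ⟨v⟩⟩ f g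
  obtain ⟨σ, hσ⟩ := h (u.comp f)
  obtain ⟨τ, hτ⟩ := h (v.comp g)
  let u' : B ↪[L] M := σ.symm.toEmbedding.comp u
  let v' : C ↪[L] M := τ.symm.toEmbedding.comp v
  let D : L.Substructure M := u'.toHom.range ⊔ v'.toHom.range
  refine ⟨CategoryTheory.Bundled.of D, mem_age_substructure ((hB.range _).sup (hC.range _)),
    (Substructure.inclusion le_sup_left).comp u'.equivRange.toEmbedding,
    (Substructure.inclusion le_sup_right).comp v'.equivRange.toEmbedding, ?_⟩
  ext x
  apply Subtype.ext
  change σ.symm (u (f x)) = τ.symm (v (g x))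
  have h1 : σ (A.subtype x) = u (f x) := hσ x
  have h2 : τ (A.subtype x) = v (g x) := hτ x
  rw [← h1, ← h2]
  simp

/-- Given `φ` on `cl(a)`, enlarge `cl(a)` to a homogeneous `cl(b)` and the range of `φ` to a
homogeneous `cl(c)`, and amalgamate the two over `cl(a)` inside `M`. Homogeneity of `cl(c)` lets an
automorphism return its copy to its original place; the copy of `cl(b)` then gives an embedding
extending `φ`, which homogeneity of `cl(b)` extends to an automorphism. -/
theorem CofinallyUltrahomogeneous.isHomogeneousTuple {M : Type w} [L.Structure M]
    (hU : CofinallyUltrahomogeneous L M) {a : List M}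
    (ha : IsAmalgamationBase (L.age M) (CategoryTheory.Bundled.of (tupleClosure L a))) :
    IsHomogeneousTuple L a := by
  rw [isHomogeneousTuple_iff]
  intro φ
  obtain ⟨b, hb, hab⟩ := hU.exists_isHomogeneousTuple a
  obtain ⟨c, hc, hac⟩ := hU.exists_isHomogeneousTuple ((tupleInClosure L a).map φ)
  rw [isHomogeneousTuple_iff] at hb hc
  have hB : tupleClosure L a ≤ tupleClosure L b := Substructure.closure_le.2 hab
  have hφ : φ.toHom.range ≤ tupleClosure L c := by
    rw [Hom.range_eq_map, ← closure_tupleInClosure a, Substructure.map_closure,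
      Substructure.closure_le]
    rintro _ ⟨x, hx, rfl⟩
    exact hac _ (List.mem_map_of_mem hx)
  let f := Substructure.inclusion hB
  let g := (Substructure.inclusion hφ).comp φ.equivRange.toEmbedding
  obtain ⟨D, ⟨-, ⟨d⟩⟩, α, β, hαβ⟩ := ha.2 _ (mem_age_substructure (fg_tupleClosure b)) _
    (mem_age_substructure (fg_tupleClosure c)) f g
  obtain ⟨σ, hσ⟩ := hc (d.comp β)
  obtain ⟨τ, hτ⟩ := hb (σ.symm.toEmbedding.comp (d.comp α))
  refine ⟨τ, fun x => ?_⟩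
  have h1 : τ x = σ.symm (d (α (f x))) := hτ (f x)
  have h2 : α (f x) = β (g x) := congrArg (fun k : tupleClosure L a ↪[L] D => k x) hαβ
  have h3 : σ (φ x) = d (β (g x)) := hσ (g x)
  rw [h1, h2, ← h3]
  simp

theorem CofinallyUltrahomogeneous.amalgamationBaseTuples_eq {M : Type w} [L.Structure M]
    (hU : CofinallyUltrahomogeneous L M) :
    amalgamationBaseTuples L M = {a | IsHomogeneousTuple L a} :=
  Set.ext fun a => ⟨hU.isHomogeneousTuple, fun h =>
    (isHomogeneousTuple_iff.1 h).isAmalgamationBase (fg_tupleClosure a)⟩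

theorem CofinallyUltrahomogeneous.isCofinalCollection {M : Type w} [L.Structure M]
    (hU : CofinallyUltrahomogeneous L M) :
    IsCofinalCollection L (amalgamationBaseTuples L M) := by
  rw [hU.amalgamationBaseTuples_eq]
  exact ⟨hU.exists_isHomogeneousTuple, fun b hb a h => IsHomogeneousTuple.append hb h,
    fun a ha b h => IsHomogeneousTuple.map ha h⟩

theorem CofinallyUltrahomogeneous.exists_append {M : Type w} [L.Structure M]
    (hU : CofinallyUltrahomogeneous L M) (a : List M) (t : List M) :
    ∃ e : List M, (∀ x ∈ t, x ∈ e) ∧ IsHomogeneousTuple L (a ++ e) := by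
  obtain ⟨b, hb, h⟩ := hU.exists_isHomogeneousTuple (a ++ t)
  refine ⟨t ++ b, fun x hx => List.mem_append_left _ hx, ?_⟩
  rw [← List.append_assoc]
  exact hb.append h

/-- This form mentions no automorphisms and so bounds the complexity. For the converse, `e` is
chosen with `a ++ e` homogeneous: the automorphism taking `a ++ e` to `b ++ f` takes `a` to `b`. -/
theorem CofinallyUltrahomogeneous.isHomogeneousTuple_iff {M : Type w} [L.Structure M]
    (hU : CofinallyUltrahomogeneous L M) (a : List M) :
    IsHomogeneousTuple L a ↔
      ∀ b e : List M, ClSim L a b → ∃ f : List M, ClSim L (a ++ e) (b ++ f) := by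
  constructor
  · intro h b e hab
    obtain ⟨τ, rfl⟩ := h b hab
    exact ⟨e.map τ, by simpa using clSim_of_embedding (a ++ e) τ.toEmbedding⟩
  · intro h b hab
    obtain ⟨e, -, he⟩ := hU.exists_append a []
    obtain ⟨f, hf⟩ := h b e hab
    obtain ⟨τ, hτ⟩ := he _ hf
    rw [List.map_append] at hτ
    exact ⟨τ, (List.append_inj hτ (by simpa using hab.1)).1⟩

end ModelTheory

end CofUH

/-! ### Closure properties of relative computability on encodable types. -/

section OracleComputability

variable {α β γ σ : Type*} [Primcodable α] [Primcodable β] [Primcodable γ] [Primcodable σ]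
variable {O : Set (ℕ →. ℕ)}

open Encodable

theorem RecursiveIn.bind {f : α →. β} {g : α → β →. σ} (hf : RecursiveIn O f)
    (hg : RecursiveIn₂ O g) : RecursiveIn O fun a => (f a).bind (g a) :=
  (Nat.RecursiveIn.comp hg
    (Nat.RecursiveIn.pair (Nat.Primrec.id.recursiveIn) hf)).of_eq fun n => by
    rcases e : decode (α := α) n with - | a
    · simp [Seq.seq]
    · simp [Seq.seq, e, encodek, Part.bind_map]
      exact (Part.map_bind _ _ _).symm

theorem RecursiveIn.comp {f : β →. σ} {g : α → β} (hf : RecursiveIn O f)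
    (hg : ComputableIn O g) : RecursiveIn O fun a => f (g a) :=
  (Nat.RecursiveIn.comp hf hg).of_eq fun n => by
    rcases decode (α := α) n with - | a <;> simp [encodek]

theorem ComputableIn.comp {f : β → σ} {g : α → β} (hf : ComputableIn O f)
    (hg : ComputableIn O g) : ComputableIn O fun a => f (g a) :=
  RecursiveIn.comp (f := fun b => Part.some (f b)) hf hg

theorem ComputableIn.pair {f : α → β} {g : α → γ} (hf : ComputableIn O f)
    (hg : ComputableIn O g) : ComputableIn O fun a => (f a, g a) :=
  (Nat.RecursiveIn.pair hf hg).of_eq fun n => by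
    rcases decode (α := α) n with - | a <;> simp [Seq.seq]

theorem RecursiveIn.map {f : α →. β} {g : α → β → σ} (hf : RecursiveIn O f)
    (hg : ComputableIn₂ O g) : RecursiveIn O fun a => (f a).map (g a) := by
  simpa [Part.bind_some_eq_map] using RecursiveIn.bind (g := fun a x => Part.some (g a x)) hf hg

theorem RecursiveIn.nat_rec {f : α → ℕ} {g : α →. σ} {h : α → ℕ × σ →. σ}
    (hf : ComputableIn O f) (hg : RecursiveIn O g) (hh : RecursiveIn₂ O h) :
    RecursiveIn O fun a => (f a).rec (g a) fun y IH => IH.bind fun i => h a (y, i) :=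
  (Nat.RecursiveIn.comp (Nat.RecursiveIn.prec hg hh)
    (Nat.RecursiveIn.pair (Nat.Primrec.id.recursiveIn) hf)).of_eq fun n => by
    rcases e : decode (α := α) n with - | a
    · simp [Seq.seq]
    · simp only [Seq.seq, Part.map_eq_map, Part.bind_eq_bind, e, Part.coe_some,
        Part.bind_some, Part.map_some, id_eq, Nat.unpair_pair]
      simp only [encode_nat]
      induction f a with
      | zero => rfl
      | succ m ih =>
        dsimp only
        rw [ih]
        simp [e, Part.bind_map, Part.map_bind, encodek]

theorem RecursiveIn.rfind {p : α → ℕ →. Bool} (hp : RecursiveIn₂ O p) :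
    RecursiveIn O fun a => Nat.rfind (p a) :=
  -- Search on codes looks for the value 0, so `true` must become 0.
  (Nat.RecursiveIn.rfind (RecursiveIn.map hp (g := fun _ b => cond b 0 1)
    (Primrec.computableIn (f := fun q : (α × ℕ) × Bool => cond q.2 0 1)
      ((Primrec.dom_bool fun b => cond b 0 1).comp Primrec.snd)))).of_eq
    fun n => by
    rcases e : decode (α := α) n with - | a
    · simpa [e] using Nat.rfind_zero_none _ rfl
    · simp [e, Part.map_map, Function.comp_def]
      have h : (fun x : Bool => decide ((bif x then 0 else 1) = 0)) = id := by
        funext x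
        cases x <;> rfl
      rw [h, show (encode : ℕ → ℕ) = id from rfl]
      simp [Part.map_id']

theorem ComputableIn.ofOption {f : α → Option β} (hf : ComputableIn O f) :
    RecursiveIn O fun a => (f a : Part β) :=
  RecursiveIn.comp (f := fun o : Option β => (o : Part β))
    (Computable.ofOption Computable.id).recursiveIn hf


end OracleComputability

namespace CofUH

/-! ### Relative decidability, indices with parameters, and quantifiers against jumps. -/

section Oracle

variable {α β γ σ : Type*} [Primcodable α] [Primcodable β] [Primcodable γ] [Primcodable σ]
variable {S : Set ℕ}

open Encodable

theorem ComputablePredIn.computableIn {p : α → Prop} [DecidablePred p]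
    (h : ComputablePredIn S p) : ComputableIn {oracleOf S} fun a => decide (p a) := by
  obtain ⟨_, h⟩ := h
  convert h

theorem ComputablePredIn.of_eq {p q : α → Prop} (h : ComputablePredIn S p)
    (hpq : ∀ a, p a ↔ q a) : ComputablePredIn S q :=
  (funext fun a => propext (hpq a) : p = q) ▸ h

theorem ComputablePredIn.comp {p : β → Prop} {f : α → β} (h : ComputablePredIn S p)
    (hf : ComputableIn {oracleOf S} f) : ComputablePredIn S fun a => p (f a) := by
  classical
  exact ⟨fun _ => inferInstance, h.computableIn.comp hf⟩

theorem ComputablePredIn.not {p : α → Prop} (h : ComputablePredIn S p) :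
    ComputablePredIn S fun a => ¬ p a := by
  classical
  refine ⟨fun _ => inferInstance, ?_⟩
  simpa using (Primrec.not.computableIn (O := {oracleOf S})).comp h.computableIn

theorem ComputablePredIn.and {p q : α → Prop} (hp : ComputablePredIn S p)
    (hq : ComputablePredIn S q) : ComputablePredIn S fun a => p a ∧ q a := by
  classical
  refine ⟨fun _ => inferInstance, ?_⟩
  simpa using (Primrec.and.computableIn₂ (O := {oracleOf S})).comp
    (hp.computableIn.pair hq.computableIn)

theorem ComputablePredIn.imp {p q : α → Prop} (hp : ComputablePredIn S p)
    (hq : ComputablePredIn S q) : ComputablePredIn S fun a => p a → q a :=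
  (hp.and hq.not).not.of_eq fun a => by tauto

theorem _root_.PrimrecPred.computablePredIn {p : α → Prop} (hp : PrimrecPred p) :
    ComputablePredIn S p := by
  obtain ⟨_, h⟩ := hp
  exact ⟨_, h.computableIn⟩

theorem _root_.ComputablePred.computablePredIn {p : α → Prop} (hp : ComputablePred p) :
    ComputablePredIn S p := by
  obtain ⟨_, h⟩ := hp
  exact ⟨_, h.computableIn⟩

theorem ComputablePredIn.mem_oracle : ComputablePredIn S fun n => n ∈ S := by
  classical
  refine ⟨fun _ => inferInstance, ?_⟩
  have h : RecursiveIn {oracleOf S} (oracleOf S) := RecursiveIn.oracle _ rfl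
  refine (h.map (g := fun _ m => decide (m = 1)) ?_).of_eq fun n => ?_
  · exact Primrec.computableIn (f := fun q : ℕ × ℕ => decide (q.2 = 1))
      (Primrec.eq.decide.comp Primrec.snd (Primrec.const 1))
  · by_cases hn : n ∈ S <;> simp [oracleOf, hn]

/-- A code for a constant function. -/
def OracleCode.const : ℕ → OracleCode
  | 0 => .zero
  | n + 1 => .comp .succ (OracleCode.const n)

theorem OracleCode.eval_const (g : ℕ →. ℕ) (k n : ℕ) :
    (OracleCode.const k).eval g n = Part.some k := by
  induction k with
  | zero => rfl
  | succ k ih => simp [OracleCode.const, OracleCode.eval, ih]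

theorem OracleCode.primrec_index_const : Primrec fun n => (OracleCode.const n).index := by
  -- The 1 is the index of `succ`; `4 * Nat.pair _ _ + 6` is the index of a composition.
  refine (Primrec.nat_rec₁ (f := fun _ i => 4 * Nat.pair 1 i + 6) 0 ?_).of_eq fun n => ?_
  · exact Primrec.nat_add.comp (Primrec.nat_mul.comp (Primrec.const 4)
      (Primrec₂.natPair.comp (Primrec.const 1) Primrec.snd)) (Primrec.const 6)
  · induction n with
    | zero => rfl
    | succ n ih => simp [OracleCode.const, OracleCode.index, ← ih]

/-- The s-m-n theorem: the code of `F` is composed with one that pairs the hardwired constant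
`encode a` with the input, `.pair .left .right` being the identity. -/
theorem exists_computable_index {F : α × ℕ →. ℕ} (hF : RecursiveIn {oracleOf S} F) :
    ∃ s : α → ℕ, Computable s ∧ ∀ a, IsIndexIn S (s a) fun n => F (a, n) := by
  obtain ⟨c, hc⟩ := OracleCode.exists_code_iff.2 (RecursiveIn.iff_nat.2 hF)
  refine ⟨fun a => (OracleCode.comp c (.pair (.const (encode a)) (.pair .left .right))).index,
    ?_, fun a => ⟨_, rfl, ?_⟩⟩
  · simp only [OracleCode.index]
    refine Primrec.to_comp (Primrec.nat_add.comp (Primrec.nat_mul.comp (Primrec.const 4)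
      (Primrec₂.natPair.comp (Primrec.const _) ?_)) (Primrec.const 6))
    refine Primrec.nat_add.comp (Primrec.nat_mul.comp (Primrec.const 4)
      (Primrec₂.natPair.comp ?_ (Primrec.const _))) (Primrec.const 5)
    exact OracleCode.primrec_index_const.comp Primrec.encode
  · funext n
    simp [OracleCode.eval, OracleCode.eval_const, Seq.seq, hc]
    exact Part.map_id' (fun _ => rfl) _

theorem computablePredIn_turingJump_dom {f : α →. σ} (hf : RecursiveIn {oracleOf S} f) :
    ComputablePredIn (turingJump S) fun a => (f a).Dom := by
  -- The function ignores its numerical input, so it halts on its own index iff `f a` is defined.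
  obtain ⟨s, hs, h⟩ := exists_computable_index (S := S) (F := fun q : α × ℕ => (f q.1).map encode)
    ((hf.comp ComputableIn.fst).map (Primrec.encode.computableIn.comp ComputableIn.snd))
  refine (ComputablePredIn.mem_oracle.comp hs.computableIn).of_eq fun a => ?_
  obtain ⟨c, hc, hc'⟩ := h a
  constructor
  · rintro ⟨d, hd, hd'⟩
    obtain rfl := OracleCode.index_injective (hc.trans hd.symm)
    rw [hc'] at hd'
    exact hd'
  · intro ha
    exact ⟨c, hc, by rw [hc']; exact ha⟩

/-- The unbounded search for a witness halts exactly when there is one. -/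
theorem ComputablePredIn.exists {p : α → ℕ → Prop}
    (hp : ComputablePredIn S fun q : α × ℕ => p q.1 q.2) :
    ComputablePredIn (turingJump S) fun a => ∃ n, p a n := by
  classical
  refine (computablePredIn_turingJump_dom (f := fun a => Nat.rfind fun n => Part.some
    (decide (p a n))) (RecursiveIn.rfind (p := fun a n => Part.some (decide (p a n)))
      hp.computableIn)).of_eq fun a => ?_
  refine Nat.rfind_dom.trans ?_
  simp

theorem ComputablePredIn.forall {p : α → ℕ → Prop}
    (hp : ComputablePredIn S fun q : α × ℕ => p q.1 q.2) :
    ComputablePredIn (turingJump S) fun a => ∀ n, p a n :=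
  (ComputablePredIn.exists (p := fun a n => ¬ p a n) hp.not).not.of_eq fun a => by simp

theorem ComputablePredIn.turingJump {p : α → Prop} (hp : ComputablePredIn S p) :
    ComputablePredIn (turingJump S) p :=
  (ComputablePredIn.exists (p := fun a _ => p a) (hp.comp ComputableIn.fst)).of_eq
    fun a => by simp

/-- Restrict a partial function to a decidable domain. -/
theorem RecursiveIn.restrict {p : α → Prop} [DecidablePred p] {f : α →. σ}
    (hp : ComputablePredIn S p) (hf : RecursiveIn {oracleOf S} f) :
    RecursiveIn {oracleOf S} fun a => if p a then f a else Part.none := by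
  have h : RecursiveIn {oracleOf S} fun a : α => ((if p a then some () else none : Option Unit) : Part Unit) := by
    apply ComputableIn.ofOption
    exact ((Primrec.dom_bool fun b => if b then some () else none).computableIn.comp
      hp.computableIn).of_eq fun a => by simp
  refine (h.bind (g := fun a _ => f a) (hf.comp ComputableIn.fst)).of_eq fun a => ?_
  by_cases ha : p a <;> simp [ha]

theorem ComputablePredIn.ite {p : α → Prop} [DecidablePred p] {f g : α → σ}
    (hp : ComputablePredIn S p) (hf : ComputableIn {oracleOf S} f)
    (hg : ComputableIn {oracleOf S} g) :
    ComputableIn {oracleOf S} fun a => if p a then f a else g a := by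
  have h : Primrec fun q : Bool × σ × σ => bif q.1 then q.2.1 else q.2.2 :=
    Primrec.cond Primrec.fst (Primrec.fst.comp Primrec.snd) (Primrec.snd.comp Primrec.snd)
  refine ((h.computableIn (O := {oracleOf S})).comp
    (hp.computableIn.pair (hf.pair hg))).of_eq fun a => ?_
  by_cases ha : p a <;> simp [ha]

end Oracle

end CofUH

namespace CofUH

/-! ### An effective back-and-forth construction for an arbitrary relation. -/

section BackAndForth

theorem TupleSim.eq_iff {M N : Type*} {a : List M} {b : List N} (h : TupleSim a b) {i j : ℕ}
    {x x' : M} {y y' : N} (hx : a[i]? = some x) (hy : b[i]? = some y) (hx' : a[j]? = some x')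
    (hy' : b[j]? = some y') : x = x' ↔ y = y' := by
  obtain ⟨hl, h⟩ := h
  obtain ⟨hi, rfl⟩ := List.getElem?_eq_some_iff.1 hx
  obtain ⟨hj, rfl⟩ := List.getElem?_eq_some_iff.1 hx'
  obtain ⟨_, rfl⟩ := List.getElem?_eq_some_iff.1 hy
  obtain ⟨_, rfl⟩ := List.getElem?_eq_some_iff.1 hy'
  exact h ⟨i, hi⟩ ⟨j, hj⟩

theorem TupleSim.exists_getElem? {M N : Type*} {a : List M} {b : List N} (h : TupleSim a b)
    {i : ℕ} {x : M} (hx : a[i]? = some x) : ∃ y, b[i]? = some y := by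
  obtain ⟨hi, rfl⟩ := List.getElem?_eq_some_iff.1 hx
  exact ⟨_, List.getElem?_eq_getElem (h.1 ▸ hi)⟩

theorem TupleSim.symm {M N : Type*} {a : List M} {b : List N} (h : TupleSim a b) :
    TupleSim b a :=
  ⟨h.1.symm, fun i j => (h.2 (i.cast h.1.symm) (j.cast h.1.symm)).symm⟩

/-- The union of the chain is the graph of a bijection: any two of its pairs occur together at a
later stage, where `TupleSim` makes it single-valued and injective. -/
theorem exists_equiv_of_chain {α : Type*} {w : ℕ → List α × List α}
    (hsim : ∀ s, TupleSim (w s).1 (w s).2) (h1 : ∀ s, (w s).1 <+: (w (s + 1)).1)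
    (h2 : ∀ s, (w s).2 <+: (w (s + 1)).2) (hc1 : ∀ x, ∃ s, x ∈ (w s).1)
    (hc2 : ∀ x, ∃ s, x ∈ (w s).2) : ∃ σ : α ≃ α, ∀ s, (w s).1.map σ = (w s).2 := by
  have mono : ∀ v : ℕ → List α, (∀ s, v s <+: v (s + 1)) → ∀ ⦃s t i : ℕ⦄ ⦃x : α⦄, s ≤ t →
      (v s)[i]? = some x → (v t)[i]? = some x := fun v hv s t i x hst h => by
    obtain ⟨u, hu⟩ : v s <+: v t :=
      Nat.le_induction (m := s) (P := fun t _ => v s <+: v t) List.prefix_rfl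
        (fun _ _ ih => ih.trans (hv _)) t hst
    obtain ⟨hi, -⟩ := List.getElem?_eq_some_iff.1 h
    rw [← hu, List.getElem?_append_left hi, h]
  let R : α → α → Prop := fun x y => ∃ s i : ℕ, (w s).1[i]? = some x ∧ (w s).2[i]? = some y
  have hR : ∀ {x y x' y'}, R x y → R x' y' → (x = x' ↔ y = y') := by
    rintro x y x' y' ⟨s, i, hx, hy⟩ ⟨t, j, hx', hy'⟩
    exact (hsim (max s t)).eq_iff (mono _ h1 (le_max_left _ _) hx)
      (mono _ h2 (le_max_left _ _) hy) (mono _ h1 (le_max_right _ _) hx')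
      (mono _ h2 (le_max_right _ _) hy')
  have hf : ∀ x, ∃ y, R x y := fun x => by
    obtain ⟨s, hs⟩ := hc1 x
    obtain ⟨i, hi⟩ := List.mem_iff_getElem?.1 hs
    obtain ⟨y, hy⟩ := (hsim s).exists_getElem? hi
    exact ⟨y, s, i, hi, hy⟩
  have hg : ∀ y, ∃ x, R x y := fun y => by
    obtain ⟨s, hs⟩ := hc2 y
    obtain ⟨i, hi⟩ := List.mem_iff_getElem?.1 hs
    obtain ⟨x, hx⟩ := (hsim s).symm.exists_getElem? hi
    exact ⟨x, s, i, hx, hi⟩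
  choose f hf using hf
  choose g hg using hg
  refine ⟨⟨f, g, fun x => (hR (hg _) (hf _)).2 rfl, fun y => (hR (hf _) (hg _)).1 rfl⟩,
    fun s => ?_⟩
  apply List.ext_getElem?
  intro i
  rw [List.getElem?_map]
  rcases hx : (w s).1[i]? with - | x
  · rw [List.getElem?_eq_none_iff, (hsim s).1] at hx
    rw [List.getElem?_eq_none hx]
    rfl
  · obtain ⟨y, hy⟩ := (hsim s).exists_getElem? hx
    rw [hy]
    exact congrArg some ((hR (hf x) ⟨s, i, hx, hy⟩).1 rfl)

theorem rawTuple_injective {M : Set ℕ} : Function.Injective (rawTuple (M := M)) :=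
  List.map_injective_iff.2 Subtype.val_injective

theorem rawTuple_append {M : Set ℕ} (a b : List M) :
    rawTuple (a ++ b) = rawTuple a ++ rawTuple b := List.map_append

theorem coe_mem_rawTuple {M : Set ℕ} {a : List M} {x : M} : (x : ℕ) ∈ rawTuple a ↔ x ∈ a :=
  List.mem_map_of_injective Subtype.val_injective

theorem mem_of_mem_rawTuple {M : Set ℕ} {a : List M} {n : ℕ} (h : n ∈ rawTuple a) : n ∈ M := by
  obtain ⟨x, -, rfl⟩ := List.mem_map.1 h
  exact x.2

/-- The relation induced on lists of natural numbers by a relation between tuples. -/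
def RawRel {M : Set ℕ} (T : List M → List M → Prop) (p : List ℕ × List ℕ) : Prop :=
  ∃ a b : List M, T a b ∧ p = (rawTuple a, rawTuple b)

theorem rawRel_rawTuple {M : Set ℕ} {T : List M → List M → Prop} {a b : List M} :
    RawRel T (rawTuple a, rawTuple b) ↔ T a b := by
  refine ⟨?_, fun h => ⟨a, b, h, rfl⟩⟩
  rintro ⟨a', b', h, heq⟩
  rw [Prod.mk.injEq] at heq
  rwa [rawTuple_injective heq.1, rawTuple_injective heq.2]

variable {M : Set ℕ} (a : ℕ → List M) (T : List M → List M → Prop)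

/-- The pair of tuples with number `n` prolongs the partial map `w` within `T` and puts `s`
into its domain and its range. -/
def Prolongs (s : ℕ) (w : List ℕ × List ℕ) (n : ℕ) : Prop :=
  RawRel T (w.1 ++ rawTuple (a n.unpair.1), w.2 ++ rawTuple (a n.unpair.2)) ∧
    (s ∈ M → s ∈ rawTuple (a n.unpair.1) ∧ s ∈ rawTuple (a n.unpair.2))

open Classical in
/-- The first prolongation of a partial map that takes care of `s`. -/
noncomputable def prolong (s : ℕ) (w : List ℕ × List ℕ) : Part (List ℕ × List ℕ) :=
  (Nat.rfind fun n => Part.some (decide (Prolongs a T s w n))).map fun n =>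
    (w.1 ++ rawTuple (a n.unpair.1), w.2 ++ rawTuple (a n.unpair.2))

/-- The stages of the back-and-forth construction from a given partial map. -/
noncomputable def backForthStage (w : List ℕ × List ℕ) (n : ℕ) : Part (List ℕ × List ℕ) :=
  n.rec (Part.some w) fun s IH => IH.bind fun v => prolong a T s v

/-- The map that results from the back-and-forth construction. -/
noncomputable def backForth (q : (List ℕ × List ℕ) × ℕ) : Part ℕ :=
  (backForthStage a T q.1 (q.2 + 1)).bind fun v => (v.2[v.1.idxOf q.2]? : Option ℕ)

variable {a T} {S : Set ℕ}

theorem primrecRel_list_mem : PrimrecRel fun (n : ℕ) (l : List ℕ) => n ∈ l :=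
  (PrimrecRel.comp (PrimrecRel.exists_mem_list (R := fun x n : ℕ => x = n) Primrec.eq)
    Primrec.snd Primrec.fst).of_eq fun q => by simp

theorem computablePredIn_prolongs (ha : Computable fun i => rawTuple (a i))
    (hM : ComputablePredIn S fun n => n ∈ M) (hT : ComputablePredIn S (RawRel T)) :
    ComputablePredIn S fun q : (ℕ × List ℕ × List ℕ) × ℕ => Prolongs a T q.1.1 q.1.2 q.2 := by
  have h1 : Computable fun q : (ℕ × List ℕ × List ℕ) × ℕ => rawTuple (a q.2.unpair.1) :=
    ha.comp (Computable.fst.comp (Computable.unpair.comp Computable.snd))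
  have h2 : Computable fun q : (ℕ × List ℕ × List ℕ) × ℕ => rawTuple (a q.2.unpair.2) :=
    ha.comp (Computable.snd.comp (Computable.unpair.comp Computable.snd))
  have hs : Computable fun q : (ℕ × List ℕ × List ℕ) × ℕ => q.1.1 :=
    Computable.fst.comp Computable.fst
  have hmem : ComputablePredIn S fun q : ℕ × List ℕ => q.1 ∈ q.2 :=
    PrimrecPred.computablePredIn primrecRel_list_mem
  refine ComputablePredIn.and (hT.comp (Computable.computableIn (Computable.pair
    (Computable.list_append.comp (Computable.fst.comp (Computable.snd.comp Computable.fst)) h1)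
    (Computable.list_append.comp (Computable.snd.comp (Computable.snd.comp Computable.fst)) h2))))
    (ComputablePredIn.imp (hM.comp hs.computableIn) (ComputablePredIn.and
      (hmem.comp (hs.pair h1).computableIn) (hmem.comp (hs.pair h2).computableIn)))

theorem recursiveIn_prolong (ha : Computable fun i => rawTuple (a i))
    (hM : ComputablePredIn S fun n => n ∈ M) (hT : ComputablePredIn S (RawRel T)) :
    RecursiveIn {oracleOf S} fun q : ℕ × List ℕ × List ℕ => prolong a T q.1 q.2 := by
  classical
  have h : RecursiveIn {oracleOf S} fun q : ℕ × List ℕ × List ℕ =>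
      Nat.rfind fun n => Part.some (decide (Prolongs a T q.1 q.2 n)) :=
    RecursiveIn.rfind (p := fun (q : ℕ × List ℕ × List ℕ) n =>
      Part.some (decide (Prolongs a T q.1 q.2 n)))
      (computablePredIn_prolongs ha hM hT).computableIn
  have h' : Computable fun p : (ℕ × List ℕ × List ℕ) × ℕ =>
      (p.1.2.1 ++ rawTuple (a p.2.unpair.1), p.1.2.2 ++ rawTuple (a p.2.unpair.2)) :=
    Computable.pair
      (Computable.list_append.comp (Computable.fst.comp (Computable.snd.comp Computable.fst))
        (ha.comp (Computable.fst.comp (Computable.unpair.comp Computable.snd))))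
      (Computable.list_append.comp (Computable.snd.comp (Computable.snd.comp Computable.fst))
        (ha.comp (Computable.snd.comp (Computable.unpair.comp Computable.snd))))
  have h'' : ComputableIn₂ {oracleOf S} fun (q : ℕ × List ℕ × List ℕ) (n : ℕ) =>
      (q.2.1 ++ rawTuple (a n.unpair.1), q.2.2 ++ rawTuple (a n.unpair.2)) := h'.computableIn
  exact h.map h''

theorem recursiveIn_backForthStage (ha : Computable fun i => rawTuple (a i))
    (hM : ComputablePredIn S fun n => n ∈ M) (hT : ComputablePredIn S (RawRel T)) :
    RecursiveIn {oracleOf S} fun q : (List ℕ × List ℕ) × ℕ => backForthStage a T q.1 q.2 := by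
  have h : RecursiveIn₂ {oracleOf S}
      fun (_ : (List ℕ × List ℕ) × ℕ) (v : ℕ × List ℕ × List ℕ) => prolong a T v.1 v.2 :=
    RecursiveIn.comp (f := fun v : ℕ × List ℕ × List ℕ => prolong a T v.1 v.2)
      (recursiveIn_prolong ha hM hT) ComputableIn.snd
  have h0 : RecursiveIn {oracleOf S} fun q : (List ℕ × List ℕ) × ℕ => Part.some q.1 :=
    ComputableIn.fst (O := {oracleOf S})
  exact (RecursiveIn.nat_rec ComputableIn.snd h0 h).of_eq fun q => rfl

theorem recursiveIn_backForth (ha : Computable fun i => rawTuple (a i))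
    (hM : ComputablePredIn S fun n => n ∈ M) (hT : ComputablePredIn S (RawRel T)) :
    RecursiveIn {oracleOf S} (backForth a T) := by
  have h1 : RecursiveIn {oracleOf S} fun q : (List ℕ × List ℕ) × ℕ =>
      backForthStage a T q.1 (q.2 + 1) :=
    RecursiveIn.comp (f := fun q : (List ℕ × List ℕ) × ℕ => backForthStage a T q.1 q.2)
      (g := fun q : (List ℕ × List ℕ) × ℕ => (q.1, q.2 + 1))
      (recursiveIn_backForthStage ha hM hT)
      (Primrec.pair Primrec.fst (Primrec.succ.comp Primrec.snd)).computableIn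
  have h2 : Primrec fun p : ((List ℕ × List ℕ) × ℕ) × (List ℕ × List ℕ) =>
      p.2.2[p.2.1.idxOf p.1.2]? :=
    Primrec.list_getElem?.comp (Primrec.snd.comp Primrec.snd)
      (Primrec.list_idxOf.comp (Primrec.snd.comp Primrec.fst) (Primrec.fst.comp Primrec.snd))
  have h3 : RecursiveIn₂ {oracleOf S} fun (q : (List ℕ × List ℕ) × ℕ) (v : List ℕ × List ℕ) =>
      ((v.2[v.1.idxOf q.2]? : Option ℕ) : Part ℕ) := ComputableIn.ofOption h2.computableIn
  exact h1.bind h3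

/-- The extension property `hext` supplies a prolongation, so the search for the first one halts. -/
theorem exists_mem_prolong (ha : ∀ t, ∃ i, a i = t)
    (hext : ∀ x y, T x y → ∀ t : List M, ∃ e f, T (x ++ e) (y ++ f) ∧ t ⊆ e ∧ t ⊆ f)
    {x y : List M} (h : T x y) (s : ℕ) :
    ∃ x' y', T x' y' ∧ (rawTuple x', rawTuple y') ∈ prolong a T s (rawTuple x, rawTuple y) ∧
      x <+: x' ∧ y <+: y' ∧ ∀ hs : s ∈ M, ⟨s, hs⟩ ∈ x' ∧ ⟨s, hs⟩ ∈ y' := by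
  classical
  have hn : ∃ n, Prolongs a T s (rawTuple x, rawTuple y) n := by
    obtain ⟨t, ht⟩ : ∃ t : List M, ∀ hs : s ∈ M, ⟨s, hs⟩ ∈ t := by
      by_cases hs : s ∈ M
      · exact ⟨[⟨s, hs⟩], fun _ => by simp⟩
      · exact ⟨[], fun h => absurd h hs⟩
    obtain ⟨e, f, hef, he, hf⟩ := hext x y h t
    obtain ⟨i, rfl⟩ := ha e
    obtain ⟨j, rfl⟩ := ha f
    refine ⟨Nat.pair i j, ?_, fun hs => ?_⟩
    · simp only [Nat.unpair_pair, ← rawTuple_append]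
      exact rawRel_rawTuple.2 hef
    · simp only [Nat.unpair_pair]
      exact ⟨coe_mem_rawTuple.2 (he (ht hs)), coe_mem_rawTuple.2 (hf (ht hs))⟩
  have hdom : (Nat.rfind fun n => Part.some
      (decide (Prolongs a T s (rawTuple x, rawTuple y) n))).Dom := by
    refine Nat.rfind_dom.2 ?_
    obtain ⟨n, hn⟩ := hn
    exact ⟨n, by simp [hn], by simp⟩
  obtain ⟨n, hn⟩ := Part.dom_iff_mem.1 hdom
  have hP : Prolongs a T s (rawTuple x, rawTuple y) n := by
    simpa using Nat.rfind_spec hn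
  refine ⟨x ++ a n.unpair.1, y ++ a n.unpair.2, ?_, ?_, List.prefix_append _ _,
    List.prefix_append _ _, fun hs => ?_⟩
  · have := hP.1
    simp only [← rawTuple_append] at this
    exact rawRel_rawTuple.1 this
  · rw [rawTuple_append, rawTuple_append]
    exact Part.mem_map _ hn
  · obtain ⟨h1, h2⟩ := hP.2 hs
    exact ⟨List.mem_append_right _ (coe_mem_rawTuple.1 h1),
      List.mem_append_right _ (coe_mem_rawTuple.1 h2)⟩

/-- The last clause keeps `T` for arbitrarily large finite parts of the limit map; it is what later
yields an automorphism. -/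
theorem backForth_spec (ha : ∀ t, ∃ i, a i = t) (hsim : ∀ x y, T x y → TupleSim x y)
    (hext : ∀ x y, T x y → ∀ t : List M, ∃ e f, T (x ++ e) (y ++ f) ∧ t ⊆ e ∧ t ⊆ f)
    {x y : List M} (h : T x y) :
    ∃ σ : M ≃ M, x.map σ = y ∧
      (∀ n m, m ∈ backForth a T ((rawTuple x, rawTuple y), n) ↔
        ∃ z : M, (z : ℕ) = n ∧ (σ z : ℕ) = m) ∧
      ∀ t : List M, ∃ p, t ⊆ p ∧ T p (p.map σ) := by
  let P : ℕ → List M × List M → Prop := fun s w => T w.1 w.2 ∧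
    (rawTuple w.1, rawTuple w.2) ∈ backForthStage a T (rawTuple x, rawTuple y) s
  have hP0 : P 0 (x, y) := ⟨h, Part.mem_some _⟩
  have hPs : ∀ s w, P s w → ∃ w', P (s + 1) w' ∧ w.1 <+: w'.1 ∧ w.2 <+: w'.2 ∧
      ∀ hs : s ∈ M, ⟨s, hs⟩ ∈ w'.1 ∧ ⟨s, hs⟩ ∈ w'.2 := by
    intro s w hw
    obtain ⟨x', y', h1, h2, h3⟩ := exists_mem_prolong ha hext hw.1 s
    exact ⟨(x', y'), ⟨h1, Part.mem_bind hw.2 h2⟩, h3⟩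
  have huniq : ∀ {s w w'}, P s w → P s w' → w = w' := fun {s w w'} hw hw' => by
    have := Part.mem_unique hw.2 hw'.2
    rw [Prod.mk.injEq] at this
    exact Prod.ext (rawTuple_injective this.1) (rawTuple_injective this.2)
  have hP : ∀ s, ∃ w, P s w := fun s => by
    induction s with
    | zero => exact ⟨_, hP0⟩
    | succ s ih =>
      obtain ⟨w, hw⟩ := ih
      obtain ⟨w', hw', -⟩ := hPs s w hw
      exact ⟨w', hw'⟩
  choose w hw using hP
  have hstep : ∀ s, (w s).1 <+: (w (s + 1)).1 ∧ (w s).2 <+: (w (s + 1)).2 ∧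
      ∀ hs : s ∈ M, ⟨s, hs⟩ ∈ (w (s + 1)).1 ∧ ⟨s, hs⟩ ∈ (w (s + 1)).2 := fun s => by
    obtain ⟨w', hw', h'⟩ := hPs s _ (hw s)
    rwa [huniq hw' (hw (s + 1))] at h'
  -- The number `z` is handled in passing from stage `z` to stage `z + 1`.
  obtain ⟨σ, hσ⟩ := exists_equiv_of_chain (fun s => hsim _ _ (hw s).1) (fun s => (hstep s).1)
    (fun s => (hstep s).2.1) (fun z => ⟨z + 1, ((hstep z).2.2 z.2).1⟩)
    (fun z => ⟨z + 1, ((hstep z).2.2 z.2).2⟩)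
  have hx : w 0 = (x, y) := huniq (hw 0) hP0
  refine ⟨σ, by simpa [hx] using hσ 0, fun n m => ?_, fun t => ?_⟩
  · have hst := Part.eq_some_iff.2 (hw (n + 1)).2
    rw [← hσ] at hst
    simp only [backForth, hst, Part.bind_some, Part.mem_ofOption, Option.mem_def]
    have key : ∀ z : M, (rawTuple ((w (z + 1)).1.map σ))[(rawTuple (w (z + 1)).1).idxOf (z : ℕ)]? =
        some (σ z : ℕ) := fun z => by
      have := List.getElem?_idxOf (coe_mem_rawTuple.2 ((hstep z).2.2 z.2).1)
      simp only [rawTuple, List.getElem?_map, Option.map_eq_some_iff] at this ⊢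
      obtain ⟨z', hz, hzz⟩ := this
      exact ⟨_, ⟨z', hz, rfl⟩, by rw [Subtype.ext hzz]⟩
    constructor
    · intro hm
      -- If `n` were absent from the left list, `idxOf` would return its length, which is out of
      -- range in the equally long right list. So a value at `n` forces `n ∈ M`.
      obtain ⟨hi, -⟩ := List.getElem?_eq_some_iff.1 hm
      have hn : n ∈ rawTuple (w (n + 1)).1 := by
        rw [← List.idxOf_lt_length_iff]
        simpa [rawTuple] using hi
      lift n to M using mem_of_mem_rawTuple hn
      rw [key n] at hm
      exact ⟨n, rfl, Option.some.inj hm⟩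
    · rintro ⟨z, rfl, rfl⟩
      exact key z
  · have : ∃ s, t ⊆ (w s).1 := by
      -- The sum is a crude upper bound for all the stages `z + 1` with `z` in `t`.
      refine ⟨(t.map fun z : M => (z : ℕ) + 1).sum, fun z hz => ?_⟩
      have hle : (z : ℕ) + 1 ≤ (t.map fun z : M => (z : ℕ) + 1).sum :=
        List.le_sum_of_mem (List.mem_map_of_mem (f := fun z : M => (z : ℕ) + 1) hz)
      have hp : (w (z + 1)).1 <+: (w (t.map fun z : M => (z : ℕ) + 1).sum).1 :=
        Nat.le_induction (m := (z : ℕ) + 1) (P := fun s _ => (w (z + 1)).1 <+: (w s).1)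
          List.prefix_rfl (fun s _ ih => ih.trans (hstep s).1) _ hle
      exact hp.subset ((hstep z).2.2 z.2).1
    obtain ⟨s, hs⟩ := this
    exact ⟨_, hs, by rw [hσ]; exact (hw s).1⟩

end BackAndForth

end CofUH

namespace CofUH

open FirstOrder FirstOrder.Language

/-! ### Complexity of the relations on tuples, and their extension properties. -/

section Main

variable {L : FirstOrder.Language.{u, v}} {M : Set ℕ} [L.Structure M] {a : ℕ → List M}
  {S : Set ℕ}

theorem IsCanonicalEnumeration.surjective {M : Set ℕ} {a : ℕ → List M}
    (ha : IsCanonicalEnumeration a) (t : List M) : ∃ i, a i = t :=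
  (ha.infinitely_often t).nonempty

/-- EmbedInfo is queried only at the generating tuples themselves; atomic formulas have the same
truth value in a closure as in `M`. -/
theorem encode_mem_embedInfo {k₀ k₁ : ℕ} :
    Encodable.encode (k₀, rawTuple (a k₀), k₁, rawTuple (a k₁)) ∈ embedInfo L a ↔
      ClSim L (a k₀) (a k₁) := by
  constructor
  · rintro ⟨i, j, b, c, h, heq⟩
    have heq := Encodable.encode_injective heq
    simp only [Prod.mk.injEq] at heq
    obtain ⟨rfl, hb, rfl, hc⟩ := heq
    rw [rawTuple_injective hb, rawTuple_injective hc]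
    exact ((clSim_of_embedding b (tupleClosure L _).subtype).symm.trans h).trans
      (clSim_of_embedding c (tupleClosure L _).subtype)
  · intro h
    refine ⟨k₀, k₁, tupleInClosure L _, tupleInClosure L _, ?_, ?_⟩
    · have h0 := clSim_of_embedding (tupleInClosure L (a k₀)) (tupleClosure L _).subtype
      have h1 := clSim_of_embedding (tupleInClosure L (a k₁)) (tupleClosure L _).subtype
      have e0 : (tupleInClosure L (a k₀)).map (tupleClosure L _).subtype = a k₀ :=
        map_val_tupleInClosure _
      have e1 : (tupleInClosure L (a k₁)).map (tupleClosure L _).subtype = a k₁ :=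
        map_val_tupleInClosure _
      rw [e0] at h0
      rw [e1] at h1
      exact (h0.trans h).trans h1.symm
    · rw [map_val_tupleInClosure, map_val_tupleInClosure]

theorem computablePredIn_eq {α β : Type*} [Primcodable α] [Primcodable β] {f g : α → β}
    (hf : Computable f) (hg : Computable g) : ComputablePredIn S fun x => f x = g x :=
  ComputablePredIn.comp (p := fun q : β × β => q.1 = q.2)
    (PrimrecPred.computablePredIn Primrec.eq) (hf.pair hg).computableIn

theorem ComputablePredIn.iff {α : Type*} [Primcodable α] {p q : α → Prop}
    (hp : ComputablePredIn S p) (hq : ComputablePredIn S q) :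
    ComputablePredIn S fun x => p x ↔ q x :=
  ((hp.imp hq).and (hq.imp hp)).of_eq fun _ => iff_def.symm

/-- The tuples with the numbers coded by `n` are the given ones, and are equivalent. -/
def ClSimAt (L : FirstOrder.Language.{u, v}) {M : Set ℕ} [L.Structure M] (a : ℕ → List M)
    (p : List ℕ × List ℕ) (n : ℕ) : Prop :=
  (rawTuple (a n.unpair.1) = p.1 ∧ rawTuple (a n.unpair.2) = p.2) ∧
    ClSim L (a n.unpair.1) (a n.unpair.2)

theorem computablePredIn_clSimAt (ha : Computable fun i => rawTuple (a i)) :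
    ComputablePredIn (embedInfo L a)
      fun q : (List ℕ × List ℕ) × ℕ => ClSimAt L a q.1 q.2 := by
  have hi : Computable fun q : (List ℕ × List ℕ) × ℕ => q.2.unpair.1 :=
    Computable.fst.comp (Computable.unpair.comp Computable.snd)
  have hj : Computable fun q : (List ℕ × List ℕ) × ℕ => q.2.unpair.2 :=
    Computable.snd.comp (Computable.unpair.comp Computable.snd)
  refine ((computablePredIn_eq (ha.comp hi) (Computable.fst.comp Computable.fst)).and
    (computablePredIn_eq (ha.comp hj) (Computable.snd.comp Computable.fst))).and
    ((ComputablePredIn.mem_oracle.comp (Computable.computableIn (Computable.encode.comp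
      (hi.pair ((ha.comp hi).pair (hj.pair (ha.comp hj))))))).of_eq fun q => ?_)
  exact encode_mem_embedInfo

theorem rawRel_clSim_iff (ha : ∀ t, ∃ i, a i = t) (p : List ℕ × List ℕ) :
    RawRel (ClSim L (M := M) (N := M)) p ↔ ∃ n, ClSimAt L a p n := by
  constructor
  · rintro ⟨x, y, h, rfl⟩
    obtain ⟨i, rfl⟩ := ha x
    obtain ⟨j, rfl⟩ := ha y
    exact ⟨Nat.pair i j, by simpa [ClSimAt] using h⟩
  · rintro ⟨n, ⟨h1, h2⟩, h⟩
    exact ⟨_, _, h, Prod.ext h1.symm h2.symm⟩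

theorem computablePredIn_rawRel_clSim (ha : IsCanonicalEnumeration a) :
    ComputablePredIn (turingJump (embedInfo L a)) (RawRel (ClSim L (M := M) (N := M))) :=
  (ComputablePredIn.exists (computablePredIn_clSimAt ha.computable)).of_eq fun p =>
    (rawRel_clSim_iff ha.surjective p).symm

theorem computablePredIn_exists_rawTuple {M : Set ℕ} {a : ℕ → List M}
    (ha : IsCanonicalEnumeration a) :
    ComputablePredIn (turingJump S) fun l : List ℕ => ∃ x : List M, rawTuple x = l :=
  (ComputablePredIn.exists (p := fun l n => rawTuple (a n) = l)
    (computablePredIn_eq (ha.computable.comp Computable.snd) Computable.fst)).of_eq fun l =>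
    ⟨fun ⟨n, h⟩ => ⟨_, h⟩, fun ⟨x, h⟩ => by
      obtain ⟨n, rfl⟩ := ha.surjective x
      exact ⟨n, h⟩⟩

/-- One jump decides both the premise `a ≈ b` and the conclusion `∃ f`; the universal quantifier
over `b`, `e` costs the second. -/
theorem computablePredIn_isHomogeneousTuple (hU : CofinallyUltrahomogeneous L M)
    (ha : IsCanonicalEnumeration a) :
    ComputablePredIn (turingJump (turingJump (embedInfo L a)))
      fun l : List ℕ => ∃ x ∈ {x : List M | IsHomogeneousTuple L x}, rawTuple x = l := by
  have hr := ha.computable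
  have hi : Computable fun q : List ℕ × ℕ => rawTuple (a q.2.unpair.1) :=
    hr.comp (Computable.fst.comp (Computable.unpair.comp Computable.snd))
  have hj : Computable fun q : List ℕ × ℕ => rawTuple (a q.2.unpair.2) :=
    hr.comp (Computable.snd.comp (Computable.unpair.comp Computable.snd))
  have h1 : ComputablePredIn (turingJump (embedInfo L a)) fun q : List ℕ × ℕ =>
      RawRel (ClSim L (M := M) (N := M)) (q.1, rawTuple (a q.2.unpair.1)) :=
    (computablePredIn_rawRel_clSim ha).comp (Computable.fst.pair hi).computableIn
  -- The single witness `m` codes the number of `f` together with the witness demanded by `ClSimAt`.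
  have h2 : ComputablePredIn (turingJump (embedInfo L a)) fun q : List ℕ × ℕ =>
      ∃ m : ℕ, ClSimAt L a (q.1 ++ rawTuple (a q.2.unpair.2),
        rawTuple (a q.2.unpair.1) ++ rawTuple (a m.unpair.1)) m.unpair.2 := by
    apply ComputablePredIn.exists
    refine ComputablePredIn.comp (computablePredIn_clSimAt hr)
      (f := fun q : (List ℕ × ℕ) × ℕ => ((q.1.1 ++ rawTuple (a q.1.2.unpair.2),
        rawTuple (a q.1.2.unpair.1) ++ rawTuple (a q.2.unpair.1)), q.2.unpair.2))
      (Computable.computableIn (Computable.pair (Computable.pair ?_ ?_) ?_))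
    · exact Computable.list_append.comp (Computable.fst.comp Computable.fst)
        (hj.comp Computable.fst)
    · exact Computable.list_append.comp (hi.comp Computable.fst)
        (hr.comp (Computable.fst.comp (Computable.unpair.comp Computable.snd)))
    · exact Computable.snd.comp (Computable.unpair.comp Computable.snd)
  refine ((computablePredIn_exists_rawTuple (S := turingJump (embedInfo L a)) ha).and
    (ComputablePredIn.forall (p := fun (l : List ℕ) (n : ℕ) =>
      RawRel (ClSim L (M := M) (N := M)) (l, rawTuple (a n.unpair.1)) →
      ∃ m : ℕ, ClSimAt L a (l ++ rawTuple (a n.unpair.2),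
        rawTuple (a n.unpair.1) ++ rawTuple (a m.unpair.1)) m.unpair.2)
      (h1.imp h2))).of_eq fun l => ?_
  have key : ∀ x b e : List M, (∃ f, ClSim L (x ++ e) (b ++ f)) ↔
      ∃ m : ℕ, ClSimAt L a (rawTuple x ++ rawTuple e, rawTuple b ++ rawTuple (a m.unpair.1))
        m.unpair.2 := by
    intro x b e
    constructor
    · rintro ⟨f, hf⟩
      obtain ⟨j, rfl⟩ := ha.surjective f
      obtain ⟨k, hk⟩ := (rawRel_clSim_iff ha.surjective _).1 (rawRel_rawTuple.2 hf)
      exact ⟨Nat.pair j k, by simpa [rawTuple_append] using hk⟩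
    · rintro ⟨m, hm⟩
      refine ⟨a m.unpair.1, ?_⟩
      rw [← rawTuple_append, ← rawTuple_append] at hm
      exact rawRel_rawTuple.1 ((rawRel_clSim_iff ha.surjective _).2 ⟨_, hm⟩)
  constructor
  · rintro ⟨⟨x, rfl⟩, h⟩
    refine ⟨x, (hU.isHomogeneousTuple_iff x).2 fun b e hb => ?_, rfl⟩
    obtain ⟨i, rfl⟩ := ha.surjective b
    obtain ⟨j, rfl⟩ := ha.surjective e
    have := h (Nat.pair i j)
    simp only [Nat.unpair_pair] at this
    exact (key _ _ _).2 (this (rawRel_rawTuple.2 hb))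
  · rintro ⟨x, hx, rfl⟩
    refine ⟨⟨x, rfl⟩, fun n hn => (key _ _ _).1 ?_⟩
    exact (hU.isHomogeneousTuple_iff x).1 hx _ _ (rawRel_rawTuple.1 hn)

/-- With `getElem?` the indices range over all of `ℕ`: for equal lengths, out-of-range indices
satisfy the equivalence automatically. -/
theorem tupleSim_iff_rawTuple {M : Set ℕ} {x y : List M} :
    TupleSim x y ↔ (rawTuple x).length = (rawTuple y).length ∧
      ∀ n : ℕ, (rawTuple x)[n.unpair.1]? = (rawTuple x)[n.unpair.2]? ↔
        (rawTuple y)[n.unpair.1]? = (rawTuple y)[n.unpair.2]? := by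
  have hval : ∀ (l : List M) (i j : ℕ), (rawTuple l)[i]? = (rawTuple l)[j]? ↔ l[i]? = l[j]? :=
    fun l i j => by
      simp only [rawTuple, List.getElem?_map]
      exact (Option.map_injective Subtype.val_injective).eq_iff
  simp only [hval]
  simp only [rawTuple, List.length_map]
  constructor
  · rintro ⟨hl, h⟩
    refine ⟨hl, fun n => ?_⟩
    by_cases hi : n.unpair.1 < x.length <;> by_cases hj : n.unpair.2 < x.length
    · have := h ⟨_, hi⟩ ⟨_, hj⟩
      simpa [hi, hj, hl ▸ hi, hl ▸ hj] using this
    all_goals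
      have hi' := hi
      have hj' := hj
      rw [hl] at hi' hj'
      simp [hi, hj, hi', hj']
  · rintro ⟨hl, h⟩
    refine ⟨hl, fun i j => ?_⟩
    have hi : (i : ℕ) < y.length := i.2.trans_eq hl
    have hj : (j : ℕ) < y.length := j.2.trans_eq hl
    simpa [hi, hj] using h (Nat.pair i j)

theorem computablePredIn_rawRel_tupleSim {M : Set ℕ} {a : ℕ → List M}
    (ha : IsCanonicalEnumeration a) :
    ComputablePredIn (turingJump S) (RawRel (TupleSim (M := M) (N := M))) := by
  have hx := computablePredIn_exists_rawTuple (S := S) ha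
  have hget : ∀ {f : (List ℕ × List ℕ) × ℕ → List ℕ} {g : (List ℕ × List ℕ) × ℕ → ℕ},
      Computable f → Computable g → Computable fun q => (f q)[g q]? :=
    fun hf hg => Computable.list_getElem?.comp hf hg
  have hi : Computable fun q : (List ℕ × List ℕ) × ℕ => q.2.unpair.1 :=
    Computable.fst.comp (Computable.unpair.comp Computable.snd)
  have hj : Computable fun q : (List ℕ × List ℕ) × ℕ => q.2.unpair.2 :=
    Computable.snd.comp (Computable.unpair.comp Computable.snd)
  have h1 : Computable fun q : (List ℕ × List ℕ) × ℕ => q.1.1 :=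
    Computable.fst.comp Computable.fst
  have h2 : Computable fun q : (List ℕ × List ℕ) × ℕ => q.1.2 :=
    Computable.snd.comp Computable.fst
  refine (((hx.comp ComputableIn.fst).and (hx.comp ComputableIn.snd)).and
    ((computablePredIn_eq (Computable.list_length.comp Computable.fst)
      (Computable.list_length.comp Computable.snd)).and
    (ComputablePredIn.forall (p := fun (q : List ℕ × List ℕ) (n : ℕ) =>
      q.1[n.unpair.1]? = q.1[n.unpair.2]? ↔ q.2[n.unpair.1]? = q.2[n.unpair.2]?)
      ((computablePredIn_eq (hget h1 hi) (hget h1 hj)).iff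
        (computablePredIn_eq (hget h2 hi) (hget h2 hj)))))).of_eq ?_
  rintro ⟨l, m⟩
  constructor
  · rintro ⟨⟨⟨x, rfl⟩, ⟨y, rfl⟩⟩, h⟩
    exact ⟨x, y, tupleSim_iff_rawTuple.2 h, rfl⟩
  · rintro ⟨x, y, h, heq⟩
    obtain ⟨rfl, rfl⟩ := Prod.mk.inj heq
    exact ⟨⟨⟨x, rfl⟩, ⟨y, rfl⟩⟩, tupleSim_iff_rawTuple.1 h⟩

/-- A finite partial injection extends to a permutation: by counting if `M` is finite, and by
cardinality of the complements otherwise. -/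
theorem TupleSim.exists_equiv {M : Type*} {x y : List M} (h : TupleSim x y) :
    ∃ σ : M ≃ M, x.map σ = y := by
  have hidx : ∀ z : {z | z ∈ x}, ∃ (i : ℕ) (t : M), x[i]? = some z.1 ∧ y[i]? = some t :=
    fun z => by
      obtain ⟨i, hi⟩ := List.mem_iff_getElem?.1 z.2
      obtain ⟨t, ht⟩ := h.exists_getElem? hi
      exact ⟨i, t, hi, ht⟩
  choose i f hi hf using hidx
  let F : {z | z ∈ x} ↪ M := ⟨f, fun z z' hz =>
    Subtype.ext ((h.eq_iff (hi z) (hf z) (hi z') (hf z')).2 hz)⟩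
  obtain ⟨σ, hσ⟩ : ∃ σ : M ≃ M, ∀ z : {z | z ∈ x}, σ z = F z := by
    rcases finite_or_infinite M with hM | hM
    · exact Cardinal.extend_function_finite F ⟨Equiv.refl M⟩
    · exact Cardinal.extend_function_of_lt F
        (((List.finite_toSet x).lt_aleph0).trans_le (Cardinal.aleph0_le_mk M)) ⟨Equiv.refl M⟩
  refine ⟨σ, List.ext_getElem? fun k => ?_⟩
  rw [List.getElem?_map]
  rcases hx : x[k]? with - | z
  · rw [List.getElem?_eq_none_iff, h.1] at hx
    rw [List.getElem?_eq_none hx]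
    rfl
  · obtain ⟨t, ht⟩ := h.exists_getElem? hx
    have hz : z ∈ x := List.mem_of_getElem? hx
    rw [ht, Option.map_some, hσ ⟨z, hz⟩]
    exact congrArg some ((h.eq_iff (hi ⟨z, hz⟩) (hf _) hx ht).1 rfl)

theorem tupleSim_map {M N : Type*} (x : List M) (σ : M ≃ N) : TupleSim x (x.map σ) :=
  ⟨by simp, by simp⟩

theorem TupleSim.exists_append {M : Type*} {x y : List M} (h : TupleSim x y) (t : List M) :
    ∃ e f : List M, TupleSim (x ++ e) (y ++ f) ∧ t ⊆ e ∧ t ⊆ f := by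
  obtain ⟨σ, rfl⟩ := h.exists_equiv
  -- Including the preimages of `t` puts `t` into the range as well as the domain.
  refine ⟨t ++ t.map σ.symm, (t ++ t.map σ.symm).map σ, ?_, List.subset_append_left _ _, ?_⟩
  · rw [← List.map_append]
    exact tupleSim_map _ _
  · simp [Function.comp_def]

theorem IsHomogeneousTuple.exists_append {M : Type w} [L.Structure M]
    (hU : CofinallyUltrahomogeneous L M) {x y : List M} (hx : IsHomogeneousTuple L x)
    (h : ClSim L x y) (t : List M) :
    ∃ e f : List M, (IsHomogeneousTuple L (x ++ e) ∧ ClSim L (x ++ e) (y ++ f)) ∧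
      t ⊆ e ∧ t ⊆ f := by
  obtain ⟨τ, rfl⟩ := hx y h
  obtain ⟨e, he, hxe⟩ := hU.exists_append x (t ++ t.map τ.symm)
  refine ⟨e, e.map τ, ⟨hxe, ?_⟩, fun z hz => he z (List.mem_append_left _ hz), fun z hz => ?_⟩
  · rw [← List.map_append]
    exact clSim_of_embedding _ τ.toEmbedding
  · exact List.mem_map.2 ⟨τ.symm z, he _ (List.mem_append_right _ (List.mem_map_of_mem hz)),
      by simp⟩

/-- Preservation of a symbol at given arguments involves only finitely many elements. -/
theorem exists_equiv_of_locally_automorphism {M : Type*} [L.Structure M] (σ : M ≃ M)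
    (h : ∀ t : List M, ∃ τ : M ≃[L] M, ∀ x ∈ t, τ x = σ x) :
    ∃ τ : M ≃[L] M, ∀ x, τ x = σ x := by
  refine ⟨⟨σ, fun {n} f x => ?_, fun {n} r x => ?_⟩, fun x => rfl⟩
  · obtain ⟨τ, hτ⟩ := h (Structure.funMap f x :: List.ofFn x)
    have hx : σ ∘ x = τ ∘ x := funext fun i => (hτ _ (by simp)).symm
    change σ _ = Structure.funMap f (σ ∘ x)
    rw [hx, ← hτ _ (by simp)]
    exact τ.map_fun f x
  · obtain ⟨τ, hτ⟩ := h (List.ofFn x)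
    have hx : σ ∘ x = τ ∘ x := funext fun i => (hτ _ (by simp)).symm
    change Structure.RelMap r (σ ∘ x) ↔ _
    rw [hx]
    exact τ.map_rel r x

end Main

end CofUH

/-! ### Assembling the collection and the uniform family of bijections. -/

open CofUH in
theorem computablyCofinallyUltrahomogeneousFor_amalgamationBaseTuples
    {L : FirstOrder.Language.{u, v}} {M : Set ℕ} [L.Structure M]
    (hM : ComputablePred fun n => n ∈ M) (hU : CofinallyUltrahomogeneous L M)
    {a : ℕ → List M} (ha : IsCanonicalEnumeration a) :
    ComputablyCofinallyUltrahomogeneousFor L M (turingJump (turingJump (embedInfo L a)))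
      (amalgamationBaseTuples L M) := by
  classical
  set S := turingJump (turingJump (embedInfo L a))
  have hE := computablePredIn_isHomogeneousTuple hU ha
  have hC : ComputablePredIn S (RawRel (ClSim L (M := M) (N := M))) :=
    (computablePredIn_rawRel_clSim ha).turingJump
  have hT : ComputablePredIn S (RawRel (TupleSim (M := M) (N := M))) :=
    computablePredIn_rawRel_tupleSim ha
  have hand : ∀ {R : List M → List M → Prop}, ComputablePredIn S (RawRel R) →
      ComputablePredIn S (RawRel fun x y => IsHomogeneousTuple L x ∧ R x y) := fun {R} hR =>
    ((hE.comp ComputableIn.fst).and hR).of_eq fun p => by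
      constructor
      · rintro ⟨⟨x, hx, hxp⟩, x', y, h, rfl⟩
        obtain rfl := rawTuple_injective hxp
        exact ⟨x, y, ⟨hx, h⟩, rfl⟩
      · rintro ⟨x, y, ⟨hx, h⟩, rfl⟩
        exact ⟨⟨x, hx, rfl⟩, x, y, h, rfl⟩
  obtain ⟨s₁, hs₁, hi₁⟩ := exists_computable_index
    (recursiveIn_backForth ha.computable hM.computablePredIn (hand hC))
  obtain ⟨s₂, hs₂, hi₂⟩ := exists_computable_index
    (recursiveIn_backForth ha.computable hM.computablePredIn hT)
  refine ⟨hU.isCofinalCollection, ?_, ?_⟩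
  · rw [hU.amalgamationBaseTuples_eq]
    exact hE
  rw [hU.amalgamationBaseTuples_eq]
  -- The oracle decides the domain and whether `≈` holds, hence which construction supplies the
  -- index.
  let g : List ℕ × List ℕ →. ℕ := fun p =>
    if RawRel (fun x y : List M => IsHomogeneousTuple L x ∧ TupleSim x y) p then
      Part.some (if RawRel (ClSim L (M := M) (N := M)) p then s₁ p else s₂ p) else Part.none
  refine ⟨g, RecursiveIn.restrict (hand hT) (ComputablePredIn.ite hC hs₁.computableIn
    hs₂.computableIn), fun p => ?_, fun x y hx hxy e he => ?_⟩
  · by_cases h : RawRel (fun x y : List M => IsHomogeneousTuple L x ∧ TupleSim x y) p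
    · simp only [g, if_pos h, Part.some_dom, true_iff]
      obtain ⟨x, y, ⟨h1, h2⟩, h3⟩ := h
      exact ⟨x, y, h1, h2, h3⟩
    · simp only [g, if_neg h, Part.not_none_dom, false_iff]
      rintro ⟨x, y, h1, h2, h3⟩
      exact h ⟨x, y, ⟨h1, h2⟩, h3⟩
  · have hp : RawRel (fun x y : List M => IsHomogeneousTuple L x ∧ TupleSim x y)
        (rawTuple x, rawTuple y) := rawRel_rawTuple.2 ⟨hx, hxy⟩
    simp only [g, if_pos hp, Part.mem_some_iff] at he
    subst he
    by_cases h : ClSim L x y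
    · rw [if_pos (rawRel_rawTuple.2 h)]
      obtain ⟨σ, h1, h2, h3⟩ := backForth_spec
        (T := fun x y => IsHomogeneousTuple L x ∧ ClSim L x y) ha.surjective
        (fun _ _ h => h.2.tupleSim) (fun _ _ h t => h.1.exists_append hU h.2 t)
        ⟨hx, h⟩
      refine ⟨σ, _, hi₁ _, h2, h1, fun _ => exists_equiv_of_locally_automorphism σ fun t => ?_⟩
      -- The finite part `p` is homogeneous and equivalent to its image, so some automorphism agrees
      -- with `σ` on it.
      obtain ⟨p, htp, hp, hpσ⟩ := h3 t
      obtain ⟨τ, hτ⟩ := hp _ hpσ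
      exact ⟨τ, fun z hz => List.map_inj_left.1 hτ z (htp hz)⟩
    · rw [if_neg fun h' => h (rawRel_rawTuple.1 h')]
      obtain ⟨σ, h1, h2, -⟩ := backForth_spec (T := TupleSim) ha.surjective
        (fun _ _ h => h) (fun _ _ h t => h.exists_append t) hxy
      exact ⟨σ, _, hi₂ _, h2, h1, fun h' => absurd h' h⟩

theorem mainTheorem9 {L : FirstOrder.Language.{u, v}} (ρ : CofUH.ComputableRepresentation L)
    (M : Set ℕ) [L.Structure M] (hM : CofUH.IsComputableStructure ρ M)
    (hU : CofUH.CofinallyUltrahomogeneous L M)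
    (a : ℕ → List M) (ha : CofUH.IsCanonicalEnumeration a) :
    CofUH.ComputablyCofinallyUltrahomogeneous L M
      (CofUH.turingJump (CofUH.turingJump (CofUH.embedInfo L a))) ∧
    CofUH.ComputablyCofinallyUltrahomogeneousFor L M
      (CofUH.turingJump (CofUH.turingJump (CofUH.embedInfo L a)))
      (CofUH.amalgamationBaseTuples L M) := by
  have h := computablyCofinallyUltrahomogeneousFor_amalgamationBaseTuples hM.carrier hU ha
  exact ⟨⟨_, h⟩, h⟩
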